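/- Let $\mathbb D$ be $\mathbb R$, $\mathbb C$ or $\mathbb H$ (the quaternions), and let $H$ be a Hilbert space over $\mathbb D$, not necessarily separable; for $\mathbb D=\mathbb H$ the scalars act on the right and the scalar product $\langle\cdot|\cdot\rangle$ is Hermitian, positive definite, and $\mathbb H$-linear in its right entry. For a bounded $\mathbb D$-linear operator $A:H\to H$ let $|A|=\sqrt{A^*A}$ be the unique self-adjoint positive bounded operator with $|A|\,|A|=A^*A$. Call $A$ of trace class if $\sum_{u\in N}\langle u|\,|A|u\rangle<+\infty$ for some Hilbert basis $N\subset H$. Consider the two assertions (i) $A$ is of trace class; (ii) $\sum_{x\in N}|\langle x|Ax\rangle|<+\infty$ for every Hilbert basis $N\subset H$. If $\mathbb D=\mathbb C$ or $\mathbb D=\mathbb H$, then (i) and (ii) are equivalent for every bounded $\mathbb D$-linear operator $A$ on $H$. If $\mathbb D=\mathbb R$, then (i) implies (ii) for every bounded linear operator $A$ on $H$, but the converse fails in infinite dimensions: on every infinite-dimensional real Hilbert space there is a bounded linear operator $A$ that satisfies (ii) but not (i). -/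

import Mathlib

open scoped Quaternion

universe u

/-! ### Real and complex Hilbert spaces -/

namespace RCLikeHilbert

variable {𝕜 H : Type*} [RCLike 𝕜] [NormedAddCommGroup H] [InnerProductSpace 𝕜 H]

/-- `N` is a Hilbert basis of `H`: an orthonormal subset whose linear span is dense. -/
def IsHilbertBasis (𝕜 : Type*) {H : Type*} [RCLike 𝕜] [NormedAddCommGroup H]
    [InnerProductSpace 𝕜 H] (N : Set H) : Prop :=
  Orthonormal 𝕜 (fun x : N => (x : H)) ∧ Dense (Submodule.span 𝕜 N : Set H)

/-- `B = |A| = √(A* A)`: `B` is a self-adjoint positive bounded operator with `B B = A* A`.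
(`ContinuousLinearMap.IsPositive` includes self-adjointness, also over `ℝ`.) -/
def IsAbsoluteValue [CompleteSpace H] (A B : H →L[𝕜] H) : Prop :=
  B.IsPositive ∧ B ∘L B = A.adjoint ∘L A

/-- `A` is of trace class: `∑_{u ∈ N} ⟨u, |A| u⟩ < ∞` for some Hilbert basis `N`. -/
def IsTraceClass [CompleteSpace H] (A : H →L[𝕜] H) : Prop :=
  ∃ B : H →L[𝕜] H, IsAbsoluteValue A B ∧
    ∃ N : Set H, IsHilbertBasis 𝕜 N ∧ Summable (fun u : N => inner 𝕜 (u : H) (B u))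

/-- `∑_{x ∈ N} |⟨x, A x⟩| < ∞` for every Hilbert basis `N`. -/
def DiagonallySummable (A : H →L[𝕜] H) : Prop :=
  ∀ N : Set H, IsHilbertBasis 𝕜 N → Summable (fun x : N => ‖inner 𝕜 (x : H) (A x)‖)

end RCLikeHilbert

/-! ### Quaternionic Hilbert spaces

Scalars act on the right, that is, through the opposite ring: `x q` is `MulOpposite.op q • x`. -/

/-- A right quaternionic vector space with a scalar product that is `ℍ`-linear in its right entry,
Hermitian and positive definite, and whose norm is `‖x‖ = √⟨x, x⟩`. Together with
`CompleteSpace H` this is a quaternionic Hilbert space. -/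
class QuaternionicInnerProductSpace (H : Type*) [NormedAddCommGroup H] [Module ℍᵐᵒᵖ H]
    extends Inner ℍ H where
  inner_add_right (x y z : H) : inner x (y + z) = inner x y + inner x z
  inner_op_smul_right (x y : H) (q : ℍ) : inner x (MulOpposite.op q • y) = inner x y * q
  star_inner (x y : H) : star (inner y x) = inner x y
  /-- `⟨x, x⟩` is the non-negative real number `‖x‖²`; definiteness holds since `‖·‖` is a norm. -/
  inner_self_eq (x : H) : inner x x = ((‖x‖ ^ 2 : ℝ) : ℍ)

namespace QuaternionicHilbert

variable {H : Type*} [NormedAddCommGroup H] [Module ℍᵐᵒᵖ H] [QuaternionicInnerProductSpace H]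

/-- `N` is a Hilbert basis of `H`: an orthonormal subset whose (right) `ℍ`-linear span is dense. -/
def IsHilbertBasis (N : Set H) : Prop :=
  (∀ u ∈ N, ‖u‖ = 1) ∧ (∀ u ∈ N, ∀ v ∈ N, u ≠ v → inner ℍ u v = 0) ∧
    Dense (Submodule.span ℍᵐᵒᵖ N : Set H)

/-- `A' = A*`: the bounded operator `A'` is the adjoint of `A`. -/
def IsAdjoint (A A' : H →L[ℍᵐᵒᵖ] H) : Prop :=
  ∀ x y : H, inner ℍ (A' x) y = inner ℍ x (A y)

/-- `B` is positive: every `⟨u, B u⟩` is a non-negative real number. -/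
def IsPositive (B : H →L[ℍᵐᵒᵖ] H) : Prop :=
  ∀ u : H, ∃ r : ℝ, 0 ≤ r ∧ inner ℍ u (B u) = (r : ℍ)

/-- `B = |A| = √(A* A)`: `B` is a self-adjoint positive bounded operator with `B B = A* A`. -/
def IsAbsoluteValue (A B : H →L[ℍᵐᵒᵖ] H) : Prop :=
  IsAdjoint B B ∧ IsPositive B ∧ ∃ A' : H →L[ℍᵐᵒᵖ] H, IsAdjoint A A' ∧ B ∘L B = A' ∘L A

/-- `A` is of trace class: `∑_{u ∈ N} ⟨u, |A| u⟩ < ∞` for some Hilbert basis `N`. -/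
def IsTraceClass (A : H →L[ℍᵐᵒᵖ] H) : Prop :=
  ∃ B : H →L[ℍᵐᵒᵖ] H, IsAbsoluteValue A B ∧
    ∃ N : Set H, IsHilbertBasis N ∧ Summable (fun u : N => inner ℍ (u : H) (B u))

/-- `∑_{x ∈ N} |⟨x, A x⟩| < ∞` for every Hilbert basis `N`. -/
def DiagonallySummable (A : H →L[ℍᵐᵒᵖ] H) : Prop :=
  ∀ N : Set H, IsHilbertBasis N → Summable (fun x : N => ‖inner ℍ (x : H) (A x)‖)

end QuaternionicHilbert

/-! All three scalar fields are treated over `ℝ`: with `Re ⟨x, y⟩` as scalar product, a space over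
`ℂ` or `ℍ` is a real Hilbert space carrying the isometries `1, i` or `1, i, j, k` (a `ScalarFrame`),
and the linear operators over the larger field are the real ones commuting with these units.

(i) ⇒ (ii): write `C = √|A|`. With `A ≈ U|A|` for a contraction `U`, the number `⟨x, A y⟩` is close
to `⟨C U* x, C y⟩`, so by AM-GM diagonal sums are controlled by Hilbert-Schmidt sums of `C U*` and
`C`, both at most the trace of `|A|` (`IsPositive.sum_abs_inner_le`). Rotating basis vectors by unit
scalars turns absolute values of scalars into real parts.

(ii) ⇒ (i): split `A = S + T` into its self-adjoint and skew-adjoint parts. A skew unit `i` makes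
`iT` self-adjoint, and (ii) controls the diagonals of both `S` and `iT`. For a self-adjoint operator
there is a basis on which `⟨x, |S| x⟩ = |⟨x, S x⟩|` (`exists_isBasis_inner_eq_abs`), so one
well-chosen basis gives trace class; no spectral theorem is needed. Over `ℍ` the operator `iT` is
only real linear, but it commutes or anticommutes with each unit, which is enough. The bounds for
`S` and `T` add up to one for `|A|`.

Over `ℝ` there is no such `i`: a skew-adjoint isometry has zero diagonal in every basis, while its
absolute value is the identity, which has infinite trace in infinite dimensions. -/

/-! ### Square roots -/

/-- In a real Banach algebra, `1 - X` has the square root `1 - Y` if `‖X‖ ≤ 1`, where `Y` is the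
limit of the iteration `Y ↦ (X + Y ^ 2) / 2` started at `0`. -/
theorem exists_one_sub_mul_self_eq {R : Type*} [NormedRing R] [NormedAlgebra ℝ R]
    [CompleteSpace R] (X : R) (hX : ‖X‖ ≤ 1) :
    ∃ Y : R, (1 - Y) * (1 - Y) = 1 - X ∧
      ∀ s : Set R, IsClosed s → (0 : R) ∈ s →
        (∀ Z ∈ s, Commute Z X → (1 / 2 : ℝ) • (X + Z * Z) ∈ s) → Y ∈ s := by
  let F : R → R := fun Z => (1 / 2 : ℝ) • (X + Z * Z)
  let Y : ℕ → R := fun n => F^[n] 0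
  have hY : ∀ n, Y (n + 1) = (1 / 2 : ℝ) • (X + Y n * Y n) := fun n =>
    Function.iterate_succ_apply' F n 0
  have hY0 : Y 0 = 0 := rfl
  -- The scalar iteration for `‖X‖ = 1` majorizes both the iterates and their increments. It stays
  -- in `[0, 1]`, so the increments telescope to a finite sum even in the borderline case.
  let f : ℝ → ℝ := fun t => (1 + t * t) / 2
  let y : ℕ → ℝ := fun n => f^[n] 0
  have hy : ∀ n, y (n + 1) = (1 + y n * y n) / 2 := fun n => Function.iterate_succ_apply' f n 0
  have hy0 : y 0 = 0 := rfl
  have hcomm : ∀ G : R, Commute G X → ∀ n, Commute G (Y n) := by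
    intro G hG n
    induction n with
    | zero => rw [hY0]; exact Commute.zero_right G
    | succ n ih => rw [hY]; exact (hG.add_right (ih.mul_right ih)).smul_right _
  have hcX : ∀ n, Commute (Y n) X := fun n => (hcomm X (Commute.refl X) n).symm
  have hcY : ∀ m n, Commute (Y m) (Y n) := fun m n => hcomm _ (hcX m) n
  have hy01 : ∀ n, 0 ≤ y n ∧ y n ≤ 1 := by
    intro n
    induction n with
    | zero => rw [hy0]; norm_num
    | succ n ih => rw [hy]; constructor <;> nlinarith [ih.1, ih.2]
  have hnorm : ∀ n, ‖Y n‖ ≤ y n := by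
    intro n
    induction n with
    | zero => rw [hY0, hy0, norm_zero]
    | succ n ih =>
      rw [hY, hy, norm_smul]
      have h1 : ‖X + Y n * Y n‖ ≤ 1 + y n * y n :=
        (norm_add_le _ _).trans (add_le_add hX ((norm_mul_le _ _).trans
          (mul_le_mul ih ih (norm_nonneg _) (hy01 n).1)))
      norm_num
      linarith
  have hdiff : ∀ n, ‖Y (n + 1) - Y n‖ ≤ y (n + 1) - y n := by
    intro n
    induction n with
    | zero => rw [hY0, hy0, sub_zero, sub_zero]; exact hnorm 1
    | succ n ih =>
      -- A difference of squares factors because all iterates commute.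
      have e : Y (n + 1 + 1) - Y (n + 1) =
          (1 / 2 : ℝ) • ((Y (n + 1) - Y n) * (Y (n + 1) + Y n)) := by
        rw [hY (n + 1), hY n, ← smul_sub, ← hY n]
        congr 1
        have := (hcY (n + 1) n).eq
        rw [mul_add, sub_mul, sub_mul, this]
        abel
      have h2 : ‖Y (n + 1) + Y n‖ ≤ y (n + 1) + y n :=
        (norm_add_le _ _).trans (add_le_add (hnorm _) (hnorm _))
      have h3 := (norm_mul_le (Y (n + 1) - Y n) (Y (n + 1) + Y n)).trans
        (mul_le_mul ih h2 (norm_nonneg _) ((norm_nonneg _).trans ih))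
      rw [e, norm_smul, hy (n + 1)]
      norm_num
      nlinarith [hy n]
  have hcauchy : CauchySeq Y := by
    refine cauchySeq_of_dist_le_of_summable (fun n => y (n + 1) - y n)
      (fun n => by rw [dist_comm, dist_eq_norm]; exact hdiff n) ?_
    refine summable_of_sum_range_le (c := 1)
      (fun n => (norm_nonneg _).trans (hdiff n)) (fun n => ?_)
    rw [Finset.sum_range_sub, hy0, sub_zero]
    exact (hy01 n).2
  obtain ⟨L, hL⟩ := cauchySeq_tendsto_of_complete hcauchy
  refine ⟨L, ?_, ?_⟩
  · have h1 : Filter.Tendsto (fun n => Y (n + 1)) Filter.atTop (nhds L) :=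
      hL.comp (Filter.tendsto_add_atTop_nat 1)
    have h2 : Filter.Tendsto (fun n => Y (n + 1)) Filter.atTop
        (nhds ((1 / 2 : ℝ) • (X + L * L))) := by
      simp_rw [hY]
      exact ((hL.mul hL).const_add X).const_smul _
    have h3 := tendsto_nhds_unique h1 h2
    have h4 : L + L = X + L * L := by
      nth_rewrite 1 2 [h3]
      rw [← add_smul]
      norm_num
    have : (1 - L) * (1 - L) = 1 - (L + L) + L * L := by noncomm_ring
    rw [this, h4]
    abel
  · intro s hs h0 hstep
    refine hs.mem_of_tendsto hL (Filter.Eventually.of_forall fun n => ?_)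
    induction n with
    | zero => exact h0
    | succ n ih => rw [hY]; exact hstep _ ih (hcX n)

namespace ContinuousLinearMap

variable {K : Type*} [NormedAddCommGroup K] [InnerProductSpace ℝ K]

/-- Positivity tested on `x - P x`. This is what gives `‖1 - P‖ ≤ 1`, and hence access to the square
root iteration. -/
theorem IsPositive.norm_sq_le_of_norm_le_one {P : K →L[ℝ] K} (hP : P.IsPositive) (h1 : ‖P‖ ≤ 1)
    (x : K) : ‖P x‖ ^ 2 ≤ inner ℝ x (P x) := by
  have h := hP.inner_nonneg_right (x - P x)
  rw [map_sub, inner_sub_left, inner_sub_right, inner_sub_right,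
    ← hP.inner_left_eq_inner_right x (P x), real_inner_self_eq_norm_sq] at h
  have h2 : inner ℝ (P x) (P (P x)) ≤ ‖P x‖ ^ 2 := by
    refine (real_inner_le_norm _ _).trans ?_
    have := P.le_of_opNorm_le h1 (P x)
    nlinarith [norm_nonneg (P x)]
  linarith

variable [CompleteSpace K]

/-- A positive operator on a real Hilbert space has a positive square root that commutes with every
operator that commutes with the given one. -/
theorem IsPositive.exists_sqrt {P : K →L[ℝ] K} (hP : P.IsPositive) :
    ∃ C : K →L[ℝ] K, C.IsPositive ∧ C * C = P ∧ ∀ G : K →L[ℝ] K, Commute G P → Commute G C := by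
  set c : ℝ := ‖P‖ + 1 with hc
  have hc0 : 0 < c := by positivity
  set Q : K →L[ℝ] K := c⁻¹ • P with hQ
  have hQpos : Q.IsPositive := hP.smul_of_nonneg (by positivity)
  have hQ1 : ‖Q‖ ≤ 1 := by
    rw [hQ, norm_smul, Real.norm_eq_abs, abs_of_pos (by positivity), inv_mul_le_one₀ hc0]
    linarith
  have hX : ‖(1 : K →L[ℝ] K) - Q‖ ≤ 1 := by
    refine opNorm_le_bound _ zero_le_one fun x => ?_
    have h1 := hQpos.norm_sq_le_of_norm_le_one hQ1 x
    have h2 : ‖((1 : K →L[ℝ] K) - Q) x‖ ^ 2 = ‖x‖ ^ 2 - 2 * inner ℝ x (Q x) + ‖Q x‖ ^ 2 := by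
      simpa using norm_sub_sq_real x (Q x)
    have h3 := hQpos.inner_nonneg_right x
    rw [one_mul]
    exact abs_le_of_sq_le_sq' (by linarith) (norm_nonneg _) |>.2
  obtain ⟨Y, hY, hs⟩ := exists_one_sub_mul_self_eq _ hX
  -- Each property of the limit (norm bound, self-adjointness, commutation) is a closed condition
  -- preserved by one step of the iteration.
  have hYn : Y ∈ Metric.closedBall (0 : K →L[ℝ] K) 1 := by
    refine hs _ Metric.isClosed_closedBall (by simp) fun Z hZ _ => ?_
    rw [mem_closedBall_zero_iff] at hZ ⊢
    rw [norm_smul]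
    have := (norm_add_le _ _).trans (add_le_add hX (norm_mul_le Z Z))
    norm_num
    nlinarith [norm_nonneg Z]
  have hYsa : Y ∈ {Z : K →L[ℝ] K | star Z = Z} := by
    refine hs _ (isClosed_eq continuous_star continuous_id) (by simp) fun Z hZ _ => ?_
    have hZ' : star Z = Z := hZ
    have hQs : star Q = Q := hQpos.isSelfAdjoint
    simp [hZ', hQs]
  have hYc : ∀ G : K →L[ℝ] K, Commute G P → Commute G Y := by
    intro G hG
    refine hs {Z | Commute G Z} ?_ (Commute.zero_right G) fun Z hZ _ => ?_
    · exact isClosed_eq (continuous_const.mul continuous_id) (continuous_id.mul continuous_const)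
    · exact ((((Commute.one_right G).sub_right (hG.smul_right _))).add_right
        (Commute.mul_right hZ hZ)).smul_right _
  have hYpos : (1 - Y : K →L[ℝ] K).IsPositive := by
    refine (isPositive_iff' _).2 ⟨(IsSelfAdjoint.one _).sub hYsa, fun x => ?_⟩
    have h1 : inner ℝ (Y x) x ≤ ‖x‖ ^ 2 := by
      refine (real_inner_le_norm _ _).trans ?_
      have := Y.le_of_opNorm_le (mem_closedBall_zero_iff.1 hYn) x
      nlinarith [norm_nonneg x]
    simp only [sub_apply, one_apply_eq_self, inner_sub_left, real_inner_self_eq_norm_sq]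
    linarith
  refine ⟨Real.sqrt c • (1 - Y), hYpos.smul_of_nonneg (Real.sqrt_nonneg c), ?_, fun G hG =>
    ((Commute.one_right G).sub_right (hYc G hG)).smul_right _⟩
  rw [smul_mul_smul_comm, Real.mul_self_sqrt hc0.le, hY, hQ, sub_sub_cancel, smul_smul,
    mul_inv_cancel₀ hc0.ne', one_smul]

end ContinuousLinearMap

/-! ### Trace estimates on real Hilbert spaces -/

namespace ContinuousLinearMap

variable {K : Type*} [NormedAddCommGroup K] [InnerProductSpace ℝ K]

theorem inner_map_map_eq_of_norm_map_eq {A B : K →L[ℝ] K} (h : ∀ x, ‖A x‖ = ‖B x‖) (x y : K) :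
    inner ℝ (A x) (A y) = inner ℝ (B x) (B y) := by
  have h1 := norm_add_sq_real (A x) (A y)
  have h2 := norm_add_sq_real (B x) (B y)
  rw [← map_add, h, h, h] at h1
  rw [← map_add] at h2
  linarith

variable [CompleteSpace K]

/-- A substitute for the polar decomposition: if `A` and the positive operator `B` satisfy
`‖A x‖ = ‖B x‖`, then `A ≈ U B` and `B ≈ U* A` for some contraction `U`. -/
theorem IsPositive.exists_approx_polar {A B : K →L[ℝ] K} (hB : B.IsPositive)
    (h : ∀ x, ‖A x‖ = ‖B x‖) {ε : ℝ} (hε : 0 < ε) :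
    ∃ U : K →L[ℝ] K, ‖U‖ ≤ 1 ∧ (∀ x, ‖A x - U (B x)‖ ≤ ε * ‖x‖) ∧
      ∀ x, inner ℝ x (B x) ≤ inner ℝ (U x) (A x) + ε * ‖x‖ ^ 2 := by
  -- The witness is `U = A (B + ε)⁻¹`; `B + ε` is bounded below by `ε`, and `R` below is its
  -- inverse.
  have hunit : IsUnit (B + ε • (1 : K →L[ℝ] K)) := by
    refine isUnit_of_forall_le_norm_inner_map _ (c := ⟨ε, hε.le⟩) hε fun x => ?_
    have := hB.inner_nonneg_left x
    refine le_trans ?_ (le_abs_self _)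
    simp only [add_apply, smul_apply, one_apply_eq_self, inner_add_left, inner_smul_left,
      real_inner_self_eq_norm_sq, conj_trivial]
    change ‖x‖ ^ 2 * ε ≤ _
    linarith
  obtain ⟨⟨M, R, hMR, hRM⟩, hM⟩ := hunit
  have hM' : M = B + ε • (1 : K →L[ℝ] K) := hM
  subst hM'
  have h1 : ∀ x, B (R x) + ε • R x = x := fun x => by simpa using congr($hMR x)
  have h2 : ∀ x, R (B x) + ε • R x = x := fun x => by simpa using congr($hRM x)
  have h3 : ∀ x, R (B x) = B (R x) := fun x => add_right_cancel ((h2 x).trans (h1 x).symm)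
  have h4 : ∀ x, ‖B (R x)‖ ≤ ‖x‖ := by
    intro x
    refine abs_le_of_sq_le_sq' ?_ (norm_nonneg _) |>.2
    have e : ‖x‖ ^ 2 = ‖B (R x)‖ ^ 2 + 2 * (ε * inner ℝ (B (R x)) (R x)) + ‖ε • R x‖ ^ 2 := by
      conv_lhs => rw [← h1 x]
      rw [norm_add_sq_real, inner_smul_right]
    have := mul_nonneg hε.le (hB.inner_nonneg_left (R x))
    nlinarith [sq_nonneg ‖ε • R x‖]
  refine ⟨A ∘L R, opNorm_le_bound _ zero_le_one fun x => ?_, fun x => ?_, fun x => ?_⟩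
  · rw [one_mul, comp_apply, h]
    exact h4 x
  · have : A x - (A ∘L R) (B x) = ε • A (R x) := by
      rw [comp_apply, ← map_sub, ← map_smul]
      congr 1
      rw [sub_eq_iff_eq_add', h2]
    rw [this, norm_smul, h, Real.norm_of_nonneg hε.le]
    exact mul_le_mul_of_nonneg_left (h4 x) hε.le
  · have e : inner ℝ x (B x) = inner ℝ (B (R x)) (B x) + ε * inner ℝ (R x) (B x) := by
      nth_rewrite 1 [← h1 x]
      rw [inner_add_left, inner_smul_left, conj_trivial]
    rw [comp_apply, inner_map_map_eq_of_norm_map_eq h, e]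
    have := real_inner_le_norm (B (R x)) x
    rw [← hB.inner_left_eq_inner_right (R x) x]
    have h5 := mul_le_mul_of_nonneg_right (h4 x) (norm_nonneg x)
    nlinarith

/-- Expand each `‖D (x i)‖ ^ 2` along `b` by Parseval, exchange the sums, and apply Bessel's
inequality for `x` to each `D* (b k)`. Only `D*` on a single basis has to be estimated. -/
theorem sum_norm_sq_le_tsum {κ σ : Type*} (b : HilbertBasis κ ℝ K) (D : K →L[ℝ] K) {g : κ → ℝ}
    (hg : ∀ k, ‖D.adjoint (b k)‖ ^ 2 ≤ g k) (hs : Summable g) {x : σ → K} (hx : Orthonormal ℝ x)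
    (s : Finset σ) : ∑ i ∈ s, ‖D (x i)‖ ^ 2 ≤ ∑' k, g k := by
  have h1 : ∀ i ∈ s, HasSum (fun k => ‖inner ℝ (x i) (D.adjoint (b k))‖ ^ 2) (‖D (x i)‖ ^ 2) := by
    intro i _
    have := b.hasSum_inner_mul_inner (D (x i)) (D (x i))
    rw [real_inner_self_eq_norm_sq] at this
    refine this.congr_fun fun k => ?_
    rw [adjoint_inner_right, real_inner_comm (D (x i)) (b k), Real.norm_eq_abs, sq_abs, sq]
  refine hasSum_le (fun k => ?_) (hasSum_sum h1) hs.hasSum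
  exact (hx.sum_inner_products_le _).trans (hg k)

/-- With `C = √B` and `A ≈ U C C`, the terms are close to `⟨C U* V x, C y⟩`. The two families `x`,
`y` leave room for scalar phases, and the contraction `V` for the polar factor of another operator.
-/
theorem IsPositive.sum_abs_inner_le {κ σ : Type*} {A B : K →L[ℝ] K} (hB : B.IsPositive)
    (h : ∀ x, ‖A x‖ = ‖B x‖) (b : HilbertBasis κ ℝ K)
    (hs : Summable fun k => inner ℝ (b k) (B (b k))) {x y : σ → K} (hx : Orthonormal ℝ x)
    (hy : Orthonormal ℝ y) {V : K →L[ℝ] K} (hV : ‖V‖ ≤ 1) (s : Finset σ) :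
    ∑ i ∈ s, |inner ℝ (V (x i)) (A (y i))| ≤ ∑' k, inner ℝ (b k) (B (b k)) := by
  obtain ⟨C, hC, hCC, -⟩ := hB.exists_sqrt
  have hCB : ∀ z, C (C z) = B z := fun z => congr($hCC z)
  have hCn : ∀ z, ‖C z‖ ^ 2 = inner ℝ z (B z) := fun z => by
    rw [← hCB, ← hC.inner_left_eq_inner_right, real_inner_self_eq_norm_sq]
  set τ := ∑' k, inner ℝ (b k) (B (b k))
  have key : ∀ ε : ℝ, 0 < ε →
      ∑ i ∈ s, |inner ℝ (V (x i)) (A (y i))| ≤ τ + ε * s.card := by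
    intro ε hε
    obtain ⟨U, hU, hA, -⟩ := hB.exists_approx_polar h hε
    have hadj : ∀ T : K →L[ℝ] K, ‖T‖ ≤ 1 → ∀ z, ‖T z‖ ≤ ‖z‖ := fun T hT z => by
      simpa using T.le_of_opNorm_le hT z
    have hD : ∑ i ∈ s, ‖(C ∘L U.adjoint ∘L V) (x i)‖ ^ 2 ≤ τ := by
      refine sum_norm_sq_le_tsum b _ (fun k => ?_) hs hx s
      rw [← hCn]
      refine pow_le_pow_left₀ (norm_nonneg _) ?_ 2
      simp only [adjoint_comp, adjoint_adjoint, comp_apply]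
      have hCadj : C.adjoint = C := hC.isSelfAdjoint
      rw [hCadj]
      refine (hadj _ ?_ _).trans (hadj U hU _)
      rwa [LinearIsometryEquiv.norm_map]
    have hC' : ∑ i ∈ s, ‖C (y i)‖ ^ 2 ≤ τ := by
      refine sum_norm_sq_le_tsum b _ (fun k => ?_) hs hy s
      have hCadj : C.adjoint = C := hC.isSelfAdjoint
      rw [hCadj, hCn]
    have hterm : ∀ i ∈ s, |inner ℝ (V (x i)) (A (y i))| ≤
        (‖(C ∘L U.adjoint ∘L V) (x i)‖ ^ 2 + ‖C (y i)‖ ^ 2) / 2 + ε := by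
      intro i _
      have e1 : inner ℝ (V (x i)) (A (y i)) =
          inner ℝ (V (x i)) (A (y i) - U (B (y i))) +
            inner ℝ ((C ∘L U.adjoint ∘L V) (x i)) (C (y i)) := by
        rw [inner_sub_right, comp_apply, comp_apply, hC.inner_left_eq_inner_right, hCB,
          adjoint_inner_left]
        ring
      have e2 : |inner ℝ (V (x i)) (A (y i) - U (B (y i)))| ≤ ε := by
        refine (abs_real_inner_le_norm _ _).trans ?_
        have a1 := hadj V hV (x i)
        have a2 := hA (y i)
        rw [hx.1 i] at a1
        rw [hy.1 i, mul_one] at a2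
        calc _ ≤ 1 * ε := mul_le_mul a1 a2 (norm_nonneg _) zero_le_one
          _ = ε := one_mul ε
      have e3 := abs_real_inner_le_norm ((C ∘L U.adjoint ∘L V) (x i)) (C (y i))
      rw [e1]
      refine (abs_add_le _ _).trans ?_
      nlinarith [sq_nonneg (‖(C ∘L U.adjoint ∘L V) (x i)‖ - ‖C (y i)‖)]
    refine (Finset.sum_le_sum hterm).trans ?_
    rw [Finset.sum_add_distrib, ← Finset.sum_div, Finset.sum_add_distrib, Finset.sum_const,
      nsmul_eq_mul]
    linarith
  -- The error is `ε` per term of the fixed finite set `s`, and `τ` does not depend on `ε`; the `+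
  -- 1` covers empty `s`.
  refine le_of_forall_pos_le_add fun δ hδ => ?_
  refine (key (δ / (s.card + 1)) (by positivity)).trans ?_
  gcongr
  rw [div_mul_eq_mul_div, div_le_iff₀ (by positivity)]
  nlinarith

/-- The triangle inequality for the trace norm: `⟨x, B x⟩` is at most `⟨U x, A x⟩` up to `ε`, and
the bounds for `S` and `T` are uniform in the contraction put in place of `U`. -/
theorem IsPositive.sum_inner_le_of_add {σ : Type*} {A B S T : K →L[ℝ] K} (hB : B.IsPositive)
    (h : ∀ x, ‖A x‖ = ‖B x‖) (hA : A = S + T) {x : σ → K} (hx : Orthonormal ℝ x) (s : Finset σ)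
    {τ₁ τ₂ : ℝ}
    (hS : ∀ V : K →L[ℝ] K, ‖V‖ ≤ 1 → ∑ i ∈ s, |inner ℝ (V (x i)) (S (x i))| ≤ τ₁)
    (hT : ∀ V : K →L[ℝ] K, ‖V‖ ≤ 1 → ∑ i ∈ s, |inner ℝ (V (x i)) (T (x i))| ≤ τ₂) :
    ∑ i ∈ s, inner ℝ (x i) (B (x i)) ≤ τ₁ + τ₂ := by
  have key : ∀ ε : ℝ, 0 < ε →
      ∑ i ∈ s, inner ℝ (x i) (B (x i)) ≤ τ₁ + τ₂ + ε * s.card := by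
    intro ε hε
    obtain ⟨U, hU, -, hUB⟩ := hB.exists_approx_polar h hε
    have hterm : ∀ i ∈ s, inner ℝ (x i) (B (x i)) ≤
        |inner ℝ (U (x i)) (S (x i))| + |inner ℝ (U (x i)) (T (x i))| + ε := by
      intro i _
      have := hUB (x i)
      rw [hA, add_apply, inner_add_right, hx.1 i] at this
      linarith [le_abs_self (inner ℝ (U (x i)) (S (x i))),
        le_abs_self (inner ℝ (U (x i)) (T (x i)))]
    refine (Finset.sum_le_sum hterm).trans ?_
    rw [Finset.sum_add_distrib, Finset.sum_add_distrib, Finset.sum_const, nsmul_eq_mul]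
    linarith [hS U hU, hT U hU]
  refine le_of_forall_pos_le_add fun δ hδ => ?_
  refine (key (δ / (s.card + 1)) (by positivity)).trans ?_
  gcongr
  rw [div_mul_eq_mul_div, div_le_iff₀ (by positivity)]
  nlinarith

end ContinuousLinearMap

/-! ### Real Hilbert spaces with a finite family of scalar units -/

/-- The action of an orthonormal `ℝ`-basis of a real division algebra of scalars (such as
`1, i, j, k`) on a real inner product space. -/
structure ScalarFrame (ι K : Type*) [NormedAddCommGroup K] [InnerProductSpace ℝ K] where
  /-- The operators of scalar multiplication. -/
  unit : ι → K →L[ℝ] K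
  /-- The index of the identity. -/
  one : ι
  unit_one (x : K) : unit one x = x
  norm_unit (a : ι) (x : K) : ‖unit a x‖ = ‖x‖
  inner_unit_of_ne (a b : ι) (x : K) : a ≠ b → inner ℝ (unit a x) (unit b x) = 0
  inner_unit_left (a : ι) : ∃ s : ℝ, ∀ x y, inner ℝ (unit a x) y = s * inner ℝ x (unit a y)
  inner_unit_unit (a b : ι) :
    ∃ c, ∃ s : ℝ, ∀ x y, inner ℝ (unit a x) (unit b y) = s * inner ℝ (unit c x) y

namespace ScalarFrame

variable {ι K : Type*} [NormedAddCommGroup K] [InnerProductSpace ℝ K] (d : ScalarFrame ι K)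

/-- Orthonormality of a set with respect to the scalars of the frame. -/
def IsOrthonormal (N : Set K) : Prop :=
  (∀ u ∈ N, ‖u‖ = 1) ∧ ∀ u ∈ N, ∀ v ∈ N, u ≠ v → ∀ a, inner ℝ (d.unit a u) v = 0

/-- A complete orthonormal set with respect to the scalars of the frame. -/
def IsBasis (N : Set K) : Prop :=
  d.IsOrthonormal N ∧ ∀ y, (∀ u ∈ N, ∀ a, inner ℝ (d.unit a u) y = 0) → y = 0

variable {d}

theorem inner_unit_unit_self (a : ι) (x y : K) :
    inner ℝ (d.unit a x) (d.unit a y) = inner ℝ x y :=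
  (ContinuousLinearMap.inner_map_map_eq_of_norm_map_eq (A := d.unit a)
    (B := ContinuousLinearMap.id ℝ K) (d.norm_unit a) x y)

theorem IsOrthonormal.orthonormal {N : Set K} (hN : d.IsOrthonormal N) :
    Orthonormal ℝ (fun u : N => (u : K)) := by
  refine ⟨fun u => hN.1 u u.2, fun u v huv => ?_⟩
  have := hN.2 u u.2 v v.2 (Subtype.coe_ne_coe.2 huv) d.one
  rwa [d.unit_one] at this

theorem IsOrthonormal.orthonormal_unit {N : Set K} (hN : d.IsOrthonormal N) :
    Orthonormal ℝ (fun p : N × ι => d.unit p.2 p.1) := by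
  refine ⟨fun p => (d.norm_unit _ _).trans (hN.1 _ p.1.2), fun p q hpq => ?_⟩
  by_cases h : p.1 = q.1
  · change inner ℝ (d.unit p.2 (p.1 : K)) (d.unit q.2 (q.1 : K)) = 0
    rw [h]
    exact d.inner_unit_of_ne _ _ _ fun h2 => hpq (Prod.ext h h2)
  · obtain ⟨c, s, hcs⟩ := d.inner_unit_unit p.2 q.2
    exact (hcs _ _).trans (by
      rw [hN.2 _ p.1.2 _ q.1.2 (Subtype.coe_ne_coe.2 h), mul_zero])

theorem IsBasis.exists_hilbertBasis [CompleteSpace K] {N : Set K} (hN : d.IsBasis N) :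
    ∃ b : HilbertBasis (N × ι) ℝ K, ∀ p, b p = d.unit p.2 p.1 := by
  have hsp : (Submodule.span ℝ (Set.range fun p : N × ι => d.unit p.2 (p.1 : K)))ᗮ = ⊥ := by
    refine (Submodule.eq_bot_iff _).2 fun y hy => hN.2 y fun u hu a => ?_
    exact (Submodule.mem_orthogonal _ _).1 hy _
      (Submodule.subset_span ⟨(⟨u, hu⟩, a), rfl⟩)
  exact ⟨HilbertBasis.mkOfOrthogonalEqBot hN.1.orthonormal_unit hsp, fun p => by
    rw [HilbertBasis.coe_mkOfOrthogonalEqBot]⟩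

theorem IsOrthonormal.insert {N : Set K} (hN : d.IsOrthonormal N) {w : K} (hw1 : ‖w‖ = 1)
    (hw : ∀ u ∈ N, ∀ a, inner ℝ (d.unit a u) w = 0) : d.IsOrthonormal (insert w N) := by
  refine ⟨?_, ?_⟩
  · rintro u (rfl | hu)
    · exact hw1
    · exact hN.1 u hu
  · rintro u (rfl | hu) v (rfl | hv) huv a
    · exact absurd rfl huv
    · obtain ⟨s, hs⟩ := d.inner_unit_left a
      rw [hs, real_inner_comm, hw v hv, mul_zero]
    · exact hw u hu a
    · exact hN.2 u hu v hv huv a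

/-- An orthonormal set can be enlarged, inside any subspace, until it is complete there. -/
theorem IsOrthonormal.exists_maximal {N₀ : Set K} (h₀ : d.IsOrthonormal N₀) (W : Submodule ℝ K)
    (hW : N₀ ⊆ W) :
    ∃ N, N₀ ⊆ N ∧ N ⊆ W ∧ d.IsOrthonormal N ∧
      ∀ w ∈ W, (∀ u ∈ N, ∀ a, inner ℝ (d.unit a u) w = 0) → w = 0 := by
  obtain ⟨N, hN₀, hN⟩ := zorn_subset_nonempty {N | N ⊆ W ∧ d.IsOrthonormal N} (by
    intro c hc hchain hne
    refine ⟨⋃₀ c, ⟨Set.sUnion_subset fun s hs => (hc hs).1, ?_, ?_⟩,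
      fun s hs => Set.subset_sUnion_of_mem hs⟩
    · rintro u ⟨s, hs, hu⟩
      exact (hc hs).2.1 u hu
    · rintro u ⟨s, hs, hu⟩ v ⟨t, ht, hv⟩
      rcases hchain.total hs ht with hst | hts
      · exact (hc ht).2.2 u (hst hu) v hv
      · exact (hc hs).2.2 u hu v (hts hv)) N₀ ⟨hW, h₀⟩
  refine ⟨N, hN₀, hN.prop.1, hN.prop.2, fun w hw hwN => ?_⟩
  by_contra hw0
  have hw' : ∀ u ∈ N, ∀ a, inner ℝ (d.unit a u) ((‖w‖⁻¹ : ℝ) • w) = 0 := fun u hu a => by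
    rw [inner_smul_right, hwN u hu a, mul_zero]
  have h1 : ‖(‖w‖⁻¹ : ℝ) • w‖ = 1 := by
    rw [norm_smul, norm_inv, norm_norm, inv_mul_cancel₀ (norm_ne_zero_iff.2 hw0)]
  have hmem : (‖w‖⁻¹ : ℝ) • w ∈ N :=
    hN.le_of_ge (y := Insert.insert ((‖w‖⁻¹ : ℝ) • w) N)
      ⟨Set.insert_subset (W.smul_mem _ hw) hN.prop.1, hN.prop.2.insert h1 hw'⟩
      (Set.subset_insert _ _) (Set.mem_insert _ _)
  have h2 := hw' _ hmem d.one
  rw [d.unit_one, real_inner_self_eq_norm_sq, h1] at h2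
  norm_num at h2

theorem IsOrthonormal.exists_isBasis {N₀ : Set K} (h₀ : d.IsOrthonormal N₀) :
    ∃ N, N₀ ⊆ N ∧ d.IsBasis N := by
  obtain ⟨N, h1, -, h2, h3⟩ := h₀.exists_maximal ⊤ (fun _ _ => trivial)
  exact ⟨N, h1, h2, fun y hy => h3 y trivial hy⟩

theorem isOrthonormal_empty : d.IsOrthonormal ∅ :=
  ⟨fun _ h => h.elim, fun _ h => h.elim⟩

variable [CompleteSpace K]

/-- Since `B` commutes with the isometric units, its diagonal entry is the same at `x` and at every
`d.unit a x`. The trace over the real basis of all such vectors is therefore a finite multiple of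
the trace over `N`. -/
theorem summable_abs_inner [Finite ι] {A B : K →L[ℝ] K} (hB : B.IsPositive)
    (h : ∀ x, ‖A x‖ = ‖B x‖) (hBd : ∀ a x, B (d.unit a x) = d.unit a (B x)) {N : Set K}
    (hN : d.IsBasis N) (hs : Summable fun u : N => inner ℝ (u : K) (B u)) :
    ∃ τ : ℝ, ∀ {σ : Type*} (x y : σ → K), Orthonormal ℝ x → Orthonormal ℝ y →
      ∀ V : K →L[ℝ] K, ‖V‖ ≤ 1 → ∀ s : Finset σ,
        ∑ i ∈ s, |inner ℝ (V (x i)) (A (y i))| ≤ τ := by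
  obtain ⟨b, hb⟩ := hN.exists_hilbertBasis
  have hsum : Summable fun p : N × ι => inner ℝ (b p) (B (b p)) := by
    have h1 : Summable fun _ : ι => (1 : ℝ) := Summable.of_finite
    refine (hs.mul_of_nonneg h1 (fun u => hB.inner_nonneg_right _)
      fun _ => zero_le_one).congr fun p => ?_
    rw [hb, hBd, inner_unit_unit_self, mul_one]
  exact ⟨_, fun x y hx hy V hV s => hB.sum_abs_inner_le h b hsum hx hy hV s⟩

/-- If every unit commutes or anticommutes with the self-adjoint operator `S`, then `⟨x, |S| x⟩` and
`|⟨x, S x⟩|` agree on some basis. -/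
theorem exists_isBasis_inner_eq_abs {S B : K →L[ℝ] K}
    (hS : IsSelfAdjoint S) (hB : B.IsPositive) (hBS : B * B = S * S) (hc : Commute B S)
    (hBd : ∀ a x, B (d.unit a x) = d.unit a (B x))
    (hSd : ∀ a, (∀ x, S (d.unit a x) = d.unit a (S x)) ∨
      ∀ x, S (d.unit a x) = -d.unit a (S x)) :
    ∃ N, d.IsBasis N ∧ ∀ x ∈ N, inner ℝ x (B x) = |inner ℝ x (S x)| := by
  have hSs : ∀ x y, inner ℝ (S x) y = inner ℝ x (S y) := fun x y =>
    hS.isSymmetric x y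
  have hBB : ∀ x, B (B x) = S (S x) := fun x => congr($hBS x)
  have hcx : ∀ x, B (S x) = S (B x) := fun x => congr($hc.eq x)
  let Z : Submodule ℝ K := (B + S).ker
  have hZ : ∀ {x}, x ∈ Z ↔ B x = -S x := fun {x} => by
    rw [← add_eq_zero_iff_eq_neg]
    exact LinearMap.mem_ker
  have hZc : IsClosed (Z : Set K) := (B + S).isClosed_ker
  have : CompleteSpace Z := hZc.completeSpace_coe
  have hW : ∀ x ∈ Zᗮ, B x = S x := by
    intro x hx
    -- `(B + S)(B - S) = 0` because `B` and `S` commute and have equal squares. For `x` orthogonal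
    -- to `Z` this yields `‖(B - S) x‖ ^ 2 = 0`.
    have h1 : ∀ y, B y - S y ∈ Z := fun y => by
      rw [hZ, map_sub, map_sub, hBB, hcx]
      abel
    have h2 : inner ℝ (B (B x - S x) - S (B x - S x)) x = 0 :=
      (Submodule.mem_orthogonal _ _).1 hx _ (h1 _)
    rw [inner_sub_left, hB.inner_left_eq_inner_right, hSs, ← inner_sub_right,
      inner_self_eq_zero] at h2
    exact sub_eq_zero.1 h2
  obtain ⟨N, -, hNW, hN, hmax⟩ :=
    (isOrthonormal_empty (d := d)).exists_maximal Zᗮ (Set.empty_subset _)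
  obtain ⟨N', hNN', hN'⟩ := hN.exists_isBasis
  refine ⟨N', hN', fun y hy => ?_⟩
  by_cases hyN : y ∈ N
  · rw [hW y (hNW hyN), abs_of_nonneg]
    rw [← hW y (hNW hyN)]
    exact hB.inner_nonneg_right y
  -- A basis vector outside the part that is maximal in `Zᗮ` must lie in `Z`: its component `w` in
  -- `Zᗮ` is orthogonal to all `d.unit a u` with `u ∈ N`. A commuting unit preserves `Z`, so both
  -- `y` and its `Z`-component are orthogonal to `d.unit a u`; an anticommuting unit carries `u`
  -- into `Z`.
  have hyZ : y ∈ Z := by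
    obtain ⟨v, hv, w, hw, hvw⟩ := Z.exists_add_mem_mem_orthogonal y
    have hw0 : w = 0 := by
      refine hmax w hw fun u hu a => ?_
      rcases hSd a with hcomm | hanti
      · have h1 : inner ℝ (d.unit a u) y = 0 :=
          hN'.1.2 u (hNN' hu) y hy (fun e => hyN (e ▸ hu)) a
        obtain ⟨s, hs⟩ := d.inner_unit_left a
        have h2 : inner ℝ (d.unit a u) v = 0 := by
          have h3 : d.unit a v ∈ Z := by
            rw [hZ, hBd, hcomm, hZ.1 hv, map_neg]
          rw [hs, real_inner_comm, (Submodule.mem_orthogonal _ _).1 (hNW hu) _ h3, mul_zero]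
        rwa [hvw, inner_add_right, h2, zero_add] at h1
      · refine (Submodule.mem_orthogonal _ _).1 hw _ ?_
        rw [hZ, hBd, hanti, hW u (hNW hu), neg_neg]
    rw [hvw, hw0, add_zero]
    exact hv
  have h4 := hB.inner_nonneg_right y
  rw [hZ.1 hyZ, inner_neg_right] at h4 ⊢
  rw [abs_of_nonpos (by linarith)]

open ContinuousLinearMap in
theorem exists_abs (A : K →L[ℝ] K) :
    ∃ B : K →L[ℝ] K, B.IsPositive ∧ B * B = star A * A ∧ (∀ x, ‖A x‖ = ‖B x‖) ∧
      ∀ G : K →L[ℝ] K, Commute G (star A * A) → Commute G B := by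
  obtain ⟨B, hB, hBB, hc⟩ := (isPositive_adjoint_comp_self A).exists_sqrt
  refine ⟨B, hB, hBB, fun x => ?_, hc⟩
  have h1 : ‖A x‖ ^ 2 = ‖B x‖ ^ 2 := by
    have : B (B x) = A.adjoint (A x) := congr($hBB x)
    rw [← real_inner_self_eq_norm_sq, ← real_inner_self_eq_norm_sq, hB.inner_left_eq_inner_right,
      this, adjoint_inner_right]
  exact (pow_left_inj₀ (norm_nonneg _) (norm_nonneg _) two_ne_zero).1 h1

end ScalarFrame

/-! ### From summable diagonals to trace class, in the presence of a skew unit -/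

namespace ScalarFrame

variable {ι K : Type*} [NormedAddCommGroup K] [InnerProductSpace ℝ K] {d : ScalarFrame ι K}
  [CompleteSpace K]

theorem star_unit {A : K →L[ℝ] K} (hA : ∀ a x, A (d.unit a x) = d.unit a (A x)) (a : ι) (x : K) :
    star A (d.unit a x) = d.unit a (star A x) := by
  have hAs : ∀ x y, inner ℝ (star A x) y = inner ℝ x (A y) := fun x y =>
    ContinuousLinearMap.adjoint_inner_left A y x
  refine ext_inner_right ℝ fun y => ?_
  obtain ⟨s, hs⟩ := d.inner_unit_left a
  rw [hAs, hs, hs, ← hA, hAs]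

variable [Finite ι]

/-- On the basis adapted to `S` the hypothesis says that `|S|` has finite trace. Since `‖T x‖ = ‖S
x‖`, the same `|S|` serves as absolute value for `T`. -/
theorem exists_sum_abs_inner_le {S T : K →L[ℝ] K} (hS : IsSelfAdjoint S)
    (hSd : ∀ a, (∀ x, S (d.unit a x) = d.unit a (S x)) ∨ ∀ x, S (d.unit a x) = -d.unit a (S x))
    (hTS : ∀ x, ‖T x‖ = ‖S x‖)
    (hsum : ∀ N, d.IsBasis N → Summable fun x : N => |inner ℝ (x : K) (S x)|) :
    ∃ τ : ℝ, ∀ {σ : Type*} (x : σ → K), Orthonormal ℝ x →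
      ∀ V : K →L[ℝ] K, ‖V‖ ≤ 1 → ∀ s : Finset σ,
        ∑ i ∈ s, |inner ℝ (V (x i)) (T (x i))| ≤ τ := by
  obtain ⟨B, hB, hBB, hn, hcomm⟩ := exists_abs S
  rw [hS.star_eq] at hBB hcomm
  have hBd : ∀ a x, B (d.unit a x) = d.unit a (B x) := by
    intro a x
    have : Commute (d.unit a) (S * S) := by
      ext x
      change d.unit a (S (S x)) = S (S (d.unit a x))
      rcases hSd a with h | h
      · rw [h, h]
      · rw [h, map_neg, h, neg_neg]
    exact congr($((hcomm _ this).eq.symm) x)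
  have hBS : Commute B S := (hcomm S ((Commute.refl S).mul_right (Commute.refl S))).symm
  obtain ⟨N, hN, hNS⟩ := exists_isBasis_inner_eq_abs hS hB hBB hBS hBd hSd
  obtain ⟨τ, hτ⟩ := summable_abs_inner hB (fun x => (hTS x).trans (hn x)) hBd hN
    ((hsum N hN).congr fun x => (hNS x x.2).symm)
  exact ⟨τ, fun x hx V hV s => hτ x x hx hx V hV s⟩

open ContinuousLinearMap in
-- The unit `a₀` plays the role of `i`. The diagonals of `S` and `iT` are those of `A` and `iA`, the
-- other halves cancelling or coinciding by symmetry.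
theorem exists_abs_summable_inner {A : K →L[ℝ] K} {a₀ : ι}
    (hskew : ∀ x y, inner ℝ (d.unit a₀ x) y = -inner ℝ x (d.unit a₀ y))
    (ha₀ : ∀ a, (∀ x, d.unit a₀ (d.unit a x) = d.unit a (d.unit a₀ x)) ∨
      ∀ x, d.unit a₀ (d.unit a x) = -d.unit a (d.unit a₀ x))
    (hA : ∀ a x, A (d.unit a x) = d.unit a (A x))
    (h₁ : ∀ N, d.IsBasis N → Summable fun x : N => |inner ℝ (x : K) (A x)|)
    (h₂ : ∀ N, d.IsBasis N → Summable fun x : N => |inner ℝ (x : K) (d.unit a₀ (A x))|) :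
    ∃ B : K →L[ℝ] K, B.IsPositive ∧ B * B = star A * A ∧
      (∀ G : K →L[ℝ] K, Commute G (star A * A) → Commute G B) ∧
      ∃ N, d.IsBasis N ∧ Summable fun x : N => inner ℝ (x : K) (B x) := by
  have hAs : ∀ x y, inner ℝ (star A x) y = inner ℝ x (A y) := fun x y => adjoint_inner_left A y x
  have hAsr : ∀ x y, inner ℝ x (star A y) = inner ℝ (A x) y := fun x y =>
    adjoint_inner_right A x y
  have hAd := star_unit hA
  set S : K →L[ℝ] K := (1 / 2 : ℝ) • (A + star A) with hSdef
  set T : K →L[ℝ] K := (1 / 2 : ℝ) • (A - star A) with hTdef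
  have hS : ∀ x, S x = (1 / 2 : ℝ) • (A x + star A x) := fun x => rfl
  have hT : ∀ x, T x = (1 / 2 : ℝ) • (A x - star A x) := fun x => rfl
  have hTs : ∀ x y, inner ℝ (T x) y = -inner ℝ x (T y) := fun x y => by
    rw [hT, hT, inner_smul_left, inner_smul_right, inner_sub_left, inner_sub_right, hAs, hAsr,
      conj_trivial]
    ring
  have hTd : ∀ a x, T (d.unit a x) = d.unit a (T x) := fun a x => by
    rw [hT, hT, hA, hAd, map_smul, map_sub]
  obtain ⟨τ₁, hτ₁⟩ := exists_sum_abs_inner_le (d := d) (S := S) (T := S)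
    ((IsSelfAdjoint.all _).smul (IsSelfAdjoint.add_star_self A))
    (fun a => Or.inl fun x => by rw [hS, hS, hA, hAd, map_smul, map_add]) (fun _ => rfl)
    (fun N hN => (h₁ N hN).congr fun x => by
      rw [hS, inner_smul_right, inner_add_right, hAsr, real_inner_comm (x : K) (A x)]
      congr 1
      ring)
  obtain ⟨τ₂, hτ₂⟩ := exists_sum_abs_inner_le (d := d) (S := d.unit a₀ * T) (T := T)
    ((isSelfAdjoint_iff_isSymmetric).2 fun x y => by
      change inner ℝ (d.unit a₀ (T x)) y = inner ℝ x (d.unit a₀ (T y))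
      rw [hskew, hTs, neg_neg, hTd])
    (fun a => (ha₀ a).imp (fun h x => by
      change d.unit a₀ (T (d.unit a x)) = d.unit a (d.unit a₀ (T x))
      rw [hTd, h]) (fun h x => by
      change d.unit a₀ (T (d.unit a x)) = -d.unit a (d.unit a₀ (T x))
      rw [hTd, h])) (fun x => (d.norm_unit a₀ _).symm)
    (fun N hN => (h₂ N hN).congr fun x => by
      change _ = |inner ℝ (x : K) (d.unit a₀ (T x))|
      have e : inner ℝ (x : K) (d.unit a₀ (star A x)) = -inner ℝ (x : K) (d.unit a₀ (A x)) := by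
        rw [← hAd, hAsr, real_inner_comm, hskew]
      rw [hT, map_smul, map_sub, inner_smul_right, inner_sub_right, e]
      congr 1
      ring)
  obtain ⟨B, hB, hBB, hn, hcomm⟩ := exists_abs A
  obtain ⟨N, -, hN⟩ := (isOrthonormal_empty (d := d)).exists_isBasis
  refine ⟨B, hB, hBB, hcomm, N, hN, ?_⟩
  refine summable_of_sum_le (c := τ₁ + τ₂) (fun x => hB.inner_nonneg_right _) fun s => ?_
  refine hB.sum_inner_le_of_add hn ?_ hN.1.orthonormal s
    (fun V hV => hτ₁ _ hN.1.orthonormal V hV s) (fun V hV => hτ₂ _ hN.1.orthonormal V hV s)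
  rw [hSdef, hTdef, ← smul_add, add_add_sub_cancel, ← two_smul ℝ A, smul_smul]
  norm_num

end ScalarFrame

/-! ### Complex Hilbert spaces -/

namespace RCLikeHilbert

section Complex

attribute [local instance] InnerProductSpace.complexToReal

variable {H : Type*} [NormedAddCommGroup H] [InnerProductSpace ℂ H]

/-- The basis `1, i` of the complex numbers. -/
def complexUnit (b : Bool) : ℂ := cond b Complex.I 1

variable (H) in
/-- The action of `1, i` on a complex Hilbert space. -/
noncomputable def complexFrame : ScalarFrame Bool H where
  unit b := (complexUnit b • ContinuousLinearMap.id ℂ H).restrictScalars ℝ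
  one := false
  unit_one x := one_smul ℂ x
  norm_unit a x := by
    change ‖complexUnit a • x‖ = ‖x‖
    cases a <;> simp [complexUnit, norm_smul]
  inner_unit_of_ne a b x hab := by
    change (inner ℂ (complexUnit a • x) (complexUnit b • x)).re = 0
    rw [inner_smul_left, inner_smul_right, inner_self_eq_norm_sq_to_K]
    cases a <;> cases b <;> simp_all [complexUnit, ← Complex.ofReal_pow]
  inner_unit_left a := by
    refine ⟨cond a (-1) 1, fun x y => ?_⟩
    change (inner ℂ (complexUnit a • x) y).re = _ * (inner ℂ x (complexUnit a • y)).re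
    rw [inner_smul_left, inner_smul_right]
    cases a <;> simp [complexUnit]
  inner_unit_unit a b := by
    refine ⟨xor a b, cond a 1 (cond b (-1) 1), fun x y => ?_⟩
    change (inner ℂ (complexUnit a • x) (complexUnit b • y)).re =
      _ * (inner ℂ (complexUnit (xor a b) • x) y).re
    rw [inner_smul_left, inner_smul_right, inner_smul_left]
    cases a <;> cases b <;> simp [complexUnit]

theorem complexFrame_unit (b : Bool) (x : H) : (complexFrame H).unit b x = complexUnit b • x := rfl

theorem forall_inner_complexFrame_eq_zero {x y : H} :
    (∀ a, inner ℝ ((complexFrame H).unit a x) y = 0) ↔ inner ℂ x y = 0 := by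
  have h : ∀ a, inner ℝ ((complexFrame H).unit a x) y =
      ((starRingEnd ℂ) (complexUnit a) * inner ℂ x y).re := fun a => by
    rw [← inner_smul_left]
    rfl
  simp only [h, Bool.forall_bool, complexUnit, Complex.ext_iff]
  simp

theorem isBasis_complexFrame_iff [CompleteSpace H] {N : Set H} :
    (complexFrame H).IsBasis N ↔ IsHilbertBasis ℂ N := by
  rw [ScalarFrame.IsBasis, ScalarFrame.IsOrthonormal, IsHilbertBasis]
  simp only [forall_inner_complexFrame_eq_zero]
  refine and_congr ⟨fun h => ⟨fun u => h.1 u u.2, fun u v huv => h.2 u u.2 v v.2 fun e =>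
    huv (Subtype.ext e)⟩, fun h => ⟨fun u hu => h.1 ⟨u, hu⟩, fun u hu v hv huv =>
    h.2 (i := ⟨u, hu⟩) (j := ⟨v, hv⟩) fun e => huv congr($e.1)⟩⟩ ?_
  rw [Submodule.dense_iff_topologicalClosure_eq_top, Submodule.topologicalClosure_eq_top_iff,
    Submodule.eq_bot_iff]
  refine forall_congr' fun y => imp_congr_left ?_
  refine ⟨fun h => ?_, fun h u hu => (Submodule.mem_orthogonal _ _).1 h u
    (Submodule.subset_span hu)⟩
  have : Submodule.span ℂ N ≤ (Submodule.span ℂ {y})ᗮ := Submodule.span_le.2 fun u hu =>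
    Submodule.mem_orthogonal_singleton_iff_inner_left.2 (h u hu)
  exact (Submodule.mem_orthogonal _ _).2 fun u hu =>
    Submodule.mem_orthogonal_singleton_iff_inner_left.1 (this hu)

theorem isPositive_restrictScalars {B : H →L[ℂ] H} (hB : B.IsPositive) :
    (B.restrictScalars ℝ).IsPositive :=
  (ContinuousLinearMap.isPositive_def).2
    ⟨fun x y => congr(Complex.re $(hB.inner_left_eq_inner_right x y)),
      fun x => hB.re_inner_nonneg_left x⟩

variable [CompleteSpace H]

theorem IsAbsoluteValue.norm_eq {𝕜 H : Type*} [RCLike 𝕜] [NormedAddCommGroup H]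
    [InnerProductSpace 𝕜 H] [CompleteSpace H] {A B : H →L[𝕜] H} (h : IsAbsoluteValue A B) (x : H) :
    ‖A x‖ = ‖B x‖ := by
  have h1 : B (B x) = A.adjoint (A x) := DFunLike.congr_fun h.2 x
  have h2 : (‖A x‖ : 𝕜) ^ 2 = (‖B x‖ : 𝕜) ^ 2 := by
    rw [← inner_self_eq_norm_sq_to_K, ← inner_self_eq_norm_sq_to_K,
      h.1.inner_left_eq_inner_right, h1, ContinuousLinearMap.adjoint_inner_right]
  exact (pow_left_inj₀ (norm_nonneg _) (norm_nonneg _) two_ne_zero).1 (by exact_mod_cast h2)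

theorem star_restrictScalars (A : H →L[ℂ] H) :
    star (A.restrictScalars ℝ) = A.adjoint.restrictScalars ℝ := by
  ext x
  refine ext_inner_right ℝ fun y => ?_
  refine (ContinuousLinearMap.adjoint_inner_left (A.restrictScalars ℝ) y x).trans ?_
  exact congr(Complex.re $((ContinuousLinearMap.adjoint_inner_left A y x).symm))

theorem exists_norm_eq_one_conj_mul (z : ℂ) :
    ∃ c : ℂ, ‖c‖ = 1 ∧ (starRingEnd ℂ) c * z = (‖z‖ : ℂ) := by
  by_cases hz : z = 0
  · exact ⟨1, by simp, by simp [hz]⟩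
  · have h0 : (‖z‖ : ℂ) ≠ 0 := by simpa using hz
    refine ⟨z / ‖z‖, by simp [hz], ?_⟩
    rw [map_div₀, Complex.conj_ofReal, div_mul_eq_mul_div, mul_comm, Complex.mul_conj,
      Complex.normSq_eq_norm_sq, div_eq_iff h0]
    push_cast
    ring

/-- Multiplying `u` by a phase in the left entry only makes `⟨u, A u⟩` equal to its modulus, so the
bound for real parts applies. -/
theorem IsTraceClass.diagonallySummable_complex {A : H →L[ℂ] H} (hA : IsTraceClass A) :
    DiagonallySummable A := by
  obtain ⟨B, hB, N, hN, hs⟩ := hA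
  obtain ⟨τ, hτ⟩ := ScalarFrame.summable_abs_inner (d := complexFrame H)
    (A := A.restrictScalars ℝ) (isPositive_restrictScalars hB.1) hB.norm_eq
    (fun a x => B.map_smul (complexUnit a) x) (isBasis_complexFrame_iff.2 hN)
    (Complex.reCLM.summable hs)
  intro M hM
  choose c hc hcz using exists_norm_eq_one_conj_mul
  refine summable_of_sum_le (c := τ) (fun _ => norm_nonneg _) fun s => ?_
  let x : M → H := fun u => c (inner ℂ (u : H) (A u)) • (u : H)
  have hx : Orthonormal ℝ x := by
    refine ⟨fun u => ?_, fun u v huv => ?_⟩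
    · rw [norm_smul, hc, hM.1.1 u, one_mul]
    · change (inner ℂ (c _ • (u : H)) (c _ • (v : H))).re = 0
      have : inner ℂ (u : H) (v : H) = 0 := hM.1.2 huv
      rw [inner_smul_left, inner_smul_right, this, mul_zero, mul_zero, Complex.zero_re]
  refine le_trans (Finset.sum_le_sum fun u _ => ?_) (hτ x (fun u => (u : H)) hx
    (isBasis_complexFrame_iff.2 hM).1.orthonormal (ContinuousLinearMap.id ℝ H)
    ContinuousLinearMap.norm_id_le s)
  change _ ≤ |(inner ℂ (c (inner ℂ (u : H) (A u)) • (u : H)) (A u)).re|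
  rw [inner_smul_left, hcz, Complex.ofReal_re]
  exact le_abs_self _

/-- The real absolute value commutes with whatever commutes with `A* A`, in particular with `i`, and
so is complex linear. -/
theorem DiagonallySummable.isTraceClass {A : H →L[ℂ] H} (hA : DiagonallySummable A) :
    IsTraceClass A := by
  have hsum : ∀ b : Bool, ∀ N, (complexFrame H).IsBasis N → Summable fun x : N =>
      |inner ℝ (x : H) ((complexFrame H).unit b (A.restrictScalars ℝ x))| := by
    intro b N hN
    refine (hA N (isBasis_complexFrame_iff.1 hN)).of_nonneg_of_le (fun _ => abs_nonneg _)
      fun x => ?_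
    change |(inner ℂ (x : H) (complexUnit b • A x)).re| ≤ _
    refine (Complex.abs_re_le_norm _).trans ?_
    rw [inner_smul_right, norm_mul]
    cases b <;> simp [complexUnit]
  obtain ⟨B, hB, hBB, hcomm, N, hN, hs⟩ :=
    ScalarFrame.exists_abs_summable_inner (d := complexFrame H) (a₀ := true)
      (A := A.restrictScalars ℝ)
      (fun x y => by
        change (inner ℂ (Complex.I • x) y).re = -(inner ℂ x (Complex.I • y)).re
        rw [inner_smul_left, inner_smul_right]
        simp)
      (fun a => Or.inl fun x => smul_comm Complex.I (complexUnit a) x)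
      (fun a x => A.map_smul (complexUnit a) x)
      (fun N hN => (hsum false N hN).congr fun x => by
        rw [complexFrame_unit, complexUnit, cond_false, one_smul])
      (hsum true)
  rw [star_restrictScalars] at hBB hcomm
  have hBI : ∀ x, B (Complex.I • x) = Complex.I • B x := by
    have : Commute ((complexFrame H).unit true)
        (A.adjoint.restrictScalars ℝ * A.restrictScalars ℝ) := by
      ext x
      change Complex.I • A.adjoint (A x) = A.adjoint (A (Complex.I • x))
      rw [map_smul, map_smul]
    exact fun x => congr($((hcomm _ this).eq.symm) x)
  let B' : H →L[ℂ] H :=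
    { toFun := B
      map_add' := map_add B
      map_smul' := fun c x => by
        have hc : ∀ z : H, c • z = c.re • z + c.im • Complex.I • z := fun z => by
          conv_lhs => rw [← Complex.re_add_im c, add_smul, mul_smul]
          rfl
        rw [RingHom.id_apply, hc, hc, map_add, map_smul, map_smul, hBI]
      cont := B.cont }
  have hreal : ∀ x y : H, (inner ℂ (B x) y).re = (inner ℂ x (B y)).re := fun x y =>
    hB.inner_left_eq_inner_right x y
  have hB' : B'.IsPositive := by
    refine (ContinuousLinearMap.isPositive_def).2
      ⟨fun x y => ?_, fun x => hB.inner_nonneg_left x⟩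
    change inner ℂ (B x) y = inner ℂ x (B y)
    refine Complex.ext (hreal x y) ?_
    have h := hreal x (Complex.I • y)
    rw [hBI, inner_smul_right, inner_smul_right] at h
    simpa using h
  refine ⟨B', ⟨hB', ?_⟩, N, isBasis_complexFrame_iff.1 hN, ?_⟩
  · ext x
    exact congr($hBB x)
  · refine (Complex.ofRealCLM.summable hs).congr fun u => ?_
    change ((inner ℂ (u : H) (B' u)).re : ℂ) = _
    exact Complex.conj_eq_iff_re.1 (by rw [inner_conj_symm, hB'.inner_left_eq_inner_right])

end Complex

end RCLikeHilbert

/-! ### Real Hilbert spaces -/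

namespace RCLikeHilbert

variable {H : Type*} [NormedAddCommGroup H] [InnerProductSpace ℝ H]

theorem IsHilbertBasis.exists_hilbertBasis [CompleteSpace H] {N : Set H}
    (hN : IsHilbertBasis ℝ N) :
    ∃ b : HilbertBasis N ℝ H, ∀ u, b u = u :=
  ⟨HilbertBasis.mk hN.1 (by
      rw [Subtype.range_coe_subtype, Set.ofPred_mem_eq, top_le_iff]
      exact Submodule.dense_iff_topologicalClosure_eq_top.1 hN.2),
    fun u => by rw [HilbertBasis.coe_mk]⟩

theorem IsTraceClass.diagonallySummable_real [CompleteSpace H] {A : H →L[ℝ] H}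
    (hA : IsTraceClass A) : DiagonallySummable A := by
  obtain ⟨B, hB, N, hN, hs⟩ := hA
  obtain ⟨b, hb⟩ := hN.exists_hilbertBasis
  intro M hM
  refine summable_of_sum_le (fun _ => norm_nonneg _) fun s =>
    hB.1.sum_abs_inner_le hB.norm_eq b (hs.congr fun u => ?_) hM.1 hM.1
      (V := ContinuousLinearMap.id ℝ H) ContinuousLinearMap.norm_id_le s
  rw [hb]

theorem IsHilbertBasis.infinite (h : ¬ FiniteDimensional ℝ H) {N : Set H}
    (hN : IsHilbertBasis ℝ N) : N.Infinite := by
  intro hfin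
  have : FiniteDimensional ℝ (Submodule.span ℝ N) := FiniteDimensional.span_of_finite ℝ hfin
  have hcl : IsClosed (Submodule.span ℝ N : Set H) := Submodule.closed_of_finiteDimensional _
  have htop : Submodule.span ℝ N = ⊤ := by
    refine SetLike.coe_injective ?_
    rw [← hcl.closure_eq, hN.2.closure_eq, Submodule.top_coe]
  rw [htop] at this
  exact h (Module.Finite.equiv Submodule.topEquiv)

/-- The absolute value of an isometry is the identity. -/
theorem IsAbsoluteValue.eq_id_of_norm_eq [CompleteSpace H] {A B : H →L[ℝ] H}
    (hB : IsAbsoluteValue A B) (hA : ∀ x, ‖A x‖ = ‖x‖) (x : H) : B x = x := by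
  have h1 : B (B x) = x := by
    refine ext_inner_right ℝ fun y => ?_
    have h2 : B (B x) = A.adjoint (A x) := DFunLike.congr_fun hB.2 x
    rw [h2, ContinuousLinearMap.adjoint_inner_left]
    exact ContinuousLinearMap.inner_map_map_eq_of_norm_map_eq
      (B := ContinuousLinearMap.id ℝ H) hA x y
  have h3 := hB.1.inner_nonneg_left (B x - x)
  -- From `B² = 1`, the vector `B x - x` is an eigenvector for `-1` unless it is zero; positivity of
  -- `B` rules the former out.
  have h4 : B (B x - x) = -(B x - x) := by rw [map_sub, h1, neg_sub]
  rw [h4, inner_neg_left, real_inner_self_eq_norm_sq] at h3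
  have h5 : ‖B x - x‖ = 0 := by nlinarith [sq_nonneg ‖B x - x‖]
  exact sub_eq_zero.1 (norm_eq_zero.1 h5)

theorem not_isTraceClass_of_norm_eq [CompleteSpace H] (h : ¬ FiniteDimensional ℝ H)
    {A : H →L[ℝ] H} (hA : ∀ x, ‖A x‖ = ‖x‖) : ¬ IsTraceClass A := by
  rintro ⟨B, hB, N, hN, hs⟩
  have : Infinite N := (hN.infinite h).to_subtype
  have h1 : Summable fun _ : N => (1 : ℝ) := hs.congr fun u => by
    rw [hB.eq_id_of_norm_eq hA, real_inner_self_eq_norm_sq, hN.1.1 u, one_pow]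
  rw [summable_const_iff] at h1
  exact one_ne_zero h1

/-- An infinite-dimensional real Hilbert space has a skew-adjoint isometry. -/
theorem exists_skew_isometry [CompleteSpace H] (h : ¬ FiniteDimensional ℝ H) :
    ∃ A : H →L[ℝ] H, (∀ x, ‖A x‖ = ‖x‖) ∧ ∀ x, inner ℝ x (A x) = 0 := by
  obtain ⟨N, b, hb⟩ := exists_hilbertBasis ℝ H
  have hN : IsHilbertBasis ℝ N := by
    refine ⟨hb ▸ b.orthonormal, ?_⟩
    have := b.dense_span
    rw [hb, Subtype.range_coe_subtype, Set.ofPred_mem_eq] at this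
    exact Submodule.dense_iff_topologicalClosure_eq_top.2 this
  have : Infinite N := (hN.infinite h).to_subtype
  -- An infinite basis can be split into pairs; `w` turns each pair by a quarter, which defines `J`
  -- with `J² = -1`.
  obtain ⟨e⟩ : Nonempty (N × Bool ≃ N) := by
    refine Cardinal.eq.1 ?_
    rw [Cardinal.mk_prod, Cardinal.mk_bool, Cardinal.lift_uzero, Cardinal.lift_ofNat]
    exact Cardinal.mul_eq_left (Cardinal.aleph0_le_mk N)
      (Cardinal.ofNat_le_aleph0.trans (Cardinal.aleph0_le_mk N)) two_ne_zero
  let v : N × Bool → H := fun p => b (e p)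
  have hv : Orthonormal ℝ v := b.orthonormal.comp e e.injective
  let w : N × Bool → H := fun p => (cond p.2 1 (-1) : ℝ) • v (p.1, !p.2)
  have hw : Orthonormal ℝ w := by
    refine ⟨fun p => ?_, fun p q hpq => ?_⟩
    · obtain ⟨n, t⟩ := p
      cases t <;> simp [w, hv.1]
    · have : inner ℝ (v (p.1, !p.2)) (v (q.1, !q.2)) = 0 := hv.2 fun he => hpq <| by
        rw [Prod.ext_iff] at he ⊢
        simpa using he
      simp [w, inner_smul_left, inner_smul_right, this]
  have hvsp : ⊤ ≤ (Submodule.span ℝ (Set.range v)).topologicalClosure := by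
    have : Set.range v = Set.range b := e.surjective.range_comp b
    rw [this, b.dense_span]
  let c : HilbertBasis (N × Bool) ℝ H := HilbertBasis.mk hv hvsp
  have hc : ∀ p, c p = v p := fun p => by rw [HilbertBasis.coe_mk]
  let J : H →ₗᵢ[ℝ] H := hw.orthogonalFamily.linearIsometry.comp c.repr.toLinearIsometry
  have hJ : ∀ p, J (v p) = w p := by
    classical
    intro p
    rw [← hc]
    change hw.orthogonalFamily.linearIsometry (c.repr (c p)) = w p
    rw [c.repr_self, OrthogonalFamily.linearIsometry_apply_single]
    simp
  have hJJ : ∀ x, J (J x) = -x := by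
    have hcl : IsClosed {x | J (J x) = -x} := by
      refine isClosed_eq ?_ continuous_neg
      exact J.continuous.comp J.continuous
    let S : Submodule ℝ H :=
      LinearMap.eqLocus (J.toLinearMap ∘ₗ J.toLinearMap) (-LinearMap.id)
    have hS : (Submodule.span ℝ (Set.range v)).topologicalClosure ≤ S := by
      refine Submodule.topologicalClosure_minimal _ (Submodule.span_le.2 ?_) hcl
      rintro _ ⟨⟨n, t⟩, rfl⟩
      change J (J (v (n, t))) = -v (n, t)
      rw [hJ]
      cases t <;> simp [w, hJ]
    exact fun x => hS (hvsp trivial)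
  refine ⟨J.toContinuousLinearMap, J.norm_map, fun x => ?_⟩
  change inner ℝ x (J x) = 0
  have h1 := J.inner_map_map x (J x)
  rw [hJJ, inner_neg_right, real_inner_comm] at h1
  linarith

theorem exists_diagonallySummable_not_isTraceClass [CompleteSpace H]
    (h : ¬ FiniteDimensional ℝ H) :
    ∃ A : H →L[ℝ] H, DiagonallySummable A ∧ ¬ IsTraceClass A := by
  obtain ⟨A, hA, hA0⟩ := exists_skew_isometry h
  refine ⟨A, fun N _ => ?_, not_isTraceClass_of_norm_eq h hA⟩
  simp only [hA0, norm_zero]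
  exact summable_zero

end RCLikeHilbert

/-! ### Quaternionic Hilbert spaces -/

namespace QuaternionicHilbert

open MulOpposite

theorem re_mul_comm (p q : ℍ) : (p * q).re = (q * p).re := by
  simp only [Quaternion.re_mul]
  ring

theorem abs_re_le_norm (q : ℍ) : |q.re| ≤ ‖q‖ := by
  refine abs_le_of_sq_le_sq ?_ (norm_nonneg q)
  rw [sq ‖q‖, ← Quaternion.normSq_eq_norm_mul_self, Quaternion.normSq_def']
  nlinarith [sq_nonneg q.imI, sq_nonneg q.imJ, sq_nonneg q.imK]

theorem exists_norm_eq_one_star_mul (z : ℍ) :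
    ∃ q : ℍ, ‖q‖ = 1 ∧ star q * z = ((‖z‖ : ℝ) : ℍ) := by
  by_cases hz : z = 0
  · exact ⟨1, by simp, by simp [hz]⟩
  · have h0 : ‖z‖ ≠ 0 := norm_ne_zero_iff.2 hz
    refine ⟨(‖z‖⁻¹ : ℝ) • z, by rw [norm_smul, norm_inv, norm_norm, inv_mul_cancel₀ h0], ?_⟩
    rw [Quaternion.star_smul, smul_mul_assoc, Quaternion.star_mul_self,
      Quaternion.normSq_eq_norm_mul_self, ← Quaternion.coe_smul, smul_eq_mul, inv_mul_cancel_left₀ h0]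

/-- The quaternions `1, i, j, k`. -/
def quaternionUnit : Bool × Bool → ℍ
  | (false, false) => 1
  | (true, false) => ⟨0, 1, 0, 0⟩
  | (false, true) => ⟨0, 0, 1, 0⟩
  | (true, true) => ⟨0, 0, 0, 1⟩

theorem re_quaternionUnit (a : Bool × Bool) :
    (quaternionUnit a).re = cond (a.1 || a.2) 0 1 := by
  rcases a with ⟨_ | _, _ | _⟩ <;> rfl

theorem imI_quaternionUnit (a : Bool × Bool) :
    (quaternionUnit a).imI = cond (a.1 && !a.2) 1 0 := by
  rcases a with ⟨_ | _, _ | _⟩ <;> rfl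

theorem imJ_quaternionUnit (a : Bool × Bool) :
    (quaternionUnit a).imJ = cond (!a.1 && a.2) 1 0 := by
  rcases a with ⟨_ | _, _ | _⟩ <;> rfl

theorem imK_quaternionUnit (a : Bool × Bool) :
    (quaternionUnit a).imK = cond (a.1 && a.2) 1 0 := by
  rcases a with ⟨_ | _, _ | _⟩ <;> rfl

attribute [local simp] re_quaternionUnit imI_quaternionUnit imJ_quaternionUnit imK_quaternionUnit

theorem norm_quaternionUnit (a : Bool × Bool) : ‖quaternionUnit a‖ = 1 := by
  have h : ‖quaternionUnit a‖ * ‖quaternionUnit a‖ = 1 := by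
    rw [← Quaternion.normSq_eq_norm_mul_self, Quaternion.normSq_def']
    rcases a with ⟨_ | _, _ | _⟩ <;> simp
  nlinarith [norm_nonneg (quaternionUnit a)]

theorem re_star_quaternionUnit_mul_of_ne {a b : Bool × Bool} (h : a ≠ b) :
    (star (quaternionUnit a) * quaternionUnit b).re = 0 := by
  rcases a with ⟨_ | _, _ | _⟩ <;> rcases b with ⟨_ | _, _ | _⟩ <;>
    simp_all

theorem exists_star_quaternionUnit_eq_smul (a : Bool × Bool) :
    ∃ s : ℝ, star (quaternionUnit a) = s • quaternionUnit a := by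
  refine ⟨cond (a.1 || a.2) (-1) 1, ?_⟩
  rcases a with ⟨_ | _, _ | _⟩ <;> ext <;> simp

theorem exists_quaternionUnit_mul_star_eq_smul (a b : Bool × Bool) :
    ∃ c, ∃ s : ℝ, quaternionUnit b * star (quaternionUnit a) = s • star (quaternionUnit c) := by
  let c : Bool × Bool := (xor a.1 b.1, xor a.2 b.2)
  -- Up to sign, units multiply like the Klein four-group, so `c` is the componentwise `xor`; the
  -- sign is read off after multiplying the equation by `quaternionUnit c` on the left.
  refine ⟨c, (quaternionUnit c * (quaternionUnit b * star (quaternionUnit a))).re, ?_⟩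
  rcases a with ⟨_ | _, _ | _⟩ <;> rcases b with ⟨_ | _, _ | _⟩ <;> ext <;>
    simp [c]

theorem quaternionUnit_commute_or (a : Bool × Bool) :
    quaternionUnit a * quaternionUnit (true, false) =
        quaternionUnit (true, false) * quaternionUnit a ∨
      quaternionUnit a * quaternionUnit (true, false) =
        -(quaternionUnit (true, false) * quaternionUnit a) := by
  rcases a with ⟨_ | _, _ | _⟩
  · left; ext <;> simp
  · right; ext <;> simp
  · left; ext <;> simp
  · right; ext <;> simp

theorem eq_zero_of_re_star_quaternionUnit_mul {z : ℍ}
    (h : ∀ a, (star (quaternionUnit a) * z).re = 0) : z = 0 := by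
  have h1 := h (false, false)
  have h2 := h (true, false)
  have h3 := h (false, true)
  have h4 := h (true, true)
  simp at h1 h2 h3 h4
  exact Quaternion.ext _ _ h1 h2 h3 h4

theorem eq_sum_smul_quaternionUnit (q : ℍ) :
    q = q.re • quaternionUnit (false, false) + q.imI • quaternionUnit (true, false) +
      q.imJ • quaternionUnit (false, true) + q.imK • quaternionUnit (true, true) := by
  ext <;> simp

section InnerProduct

variable {H : Type*} [NormedAddCommGroup H] [Module ℍᵐᵒᵖ H] [QuaternionicInnerProductSpace H]

open QuaternionicInnerProductSpace

theorem inner_op_smul_left (q : ℍ) (x y : H) :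
    inner ℍ (op q • x) y = star q * inner ℍ x y := by
  rw [← star_inner (op q • x) y, inner_op_smul_right, star_mul, star_inner]

theorem inner_add_left (x y z : H) : inner ℍ (x + y) z = inner ℍ x z + inner ℍ y z := by
  rw [← star_inner (x + y) z, QuaternionicInnerProductSpace.inner_add_right, star_add,
    star_inner, star_inner]

theorem norm_op_smul (q : ℍ) (x : H) : ‖op q • x‖ = ‖q‖ * ‖x‖ := by
  have h := inner_self_eq (op q • x)
  rw [inner_op_smul_left, inner_op_smul_right, inner_self_eq, Quaternion.coe_mul_eq_smul,
    mul_smul_comm, Quaternion.star_mul_self, ← Quaternion.coe_smul, Quaternion.coe_inj,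
    Quaternion.normSq_eq_norm_mul_self, smul_eq_mul] at h
  refine (pow_left_inj₀ (norm_nonneg _) (by positivity) two_ne_zero).1 ?_
  rw [← h]
  ring

/-- The underlying real vector space. -/
noncomputable abbrev realModule (H : Type*) [NormedAddCommGroup H] [Module ℍᵐᵒᵖ H] : Module ℝ H :=
  Module.compHom H (algebraMap ℝ ℍᵐᵒᵖ)

/-- The underlying real normed space. -/
noncomputable abbrev realNormedSpace (H : Type*) [NormedAddCommGroup H] [Module ℍᵐᵒᵖ H]
    [QuaternionicInnerProductSpace H] : NormedSpace ℝ H :=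
  { realModule H with
    norm_smul_le := fun r x => by
      change ‖op (r : ℍ) • x‖ ≤ _
      rw [norm_op_smul, Quaternion.norm_coe] }

/-- The underlying real inner product space, with the scalar product `Re ⟨x, y⟩`. -/
noncomputable abbrev realInnerProductSpace (H : Type*) [NormedAddCommGroup H] [Module ℍᵐᵒᵖ H]
    [QuaternionicInnerProductSpace H] : InnerProductSpace ℝ H :=
  { realNormedSpace H with
    inner := fun x y => (inner ℍ x y).re
    norm_sq_eq_re_inner := fun x => by
      rw [inner_self_eq, Quaternion.re_coe]
      rfl
    conj_inner_symm := fun x y => by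
      rw [← star_inner x y, Quaternion.re_star]
      rfl
    add_left := fun x y z => by rw [inner_add_left, Quaternion.re_add]
    smul_left := fun x y r => by
      change (inner ℍ (op (r : ℍ) • x) y).re = _
      rw [inner_op_smul_left, Quaternion.star_coe, Quaternion.coe_mul_eq_smul,
        Quaternion.re_smul]
      rfl }

end InnerProduct

end QuaternionicHilbert

/-! ### Descent to the real structure and return to `ℍ`-linear operators -/

namespace QuaternionicHilbert

open MulOpposite QuaternionicInnerProductSpace

attribute [local instance] realModule realNormedSpace realInnerProductSpace

section

variable {H : Type*} [NormedAddCommGroup H] [Module ℍᵐᵒᵖ H]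

theorem real_smul_eq (r : ℝ) (x : H) : r • x = op (r : ℍ) • x := rfl

theorem isScalarTower_real : IsScalarTower ℝ ℍᵐᵒᵖ H :=
  ⟨fun r q x => by
    rw [Algebra.smul_def, mul_smul]
    rfl⟩

attribute [local instance] isScalarTower_real

theorem smul_op_smul (r : ℝ) (q : ℍ) (x : H) : r • op q • x = op q • r • x := by
  rw [real_smul_eq, real_smul_eq, smul_smul, smul_smul, ← op_mul, ← op_mul,
    Quaternion.coe_commutes]

variable [QuaternionicInnerProductSpace H]

theorem real_inner_eq_re (x y : H) : inner ℝ x y = (inner ℍ x y).re := rfl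

variable (H) in
/-- Scalar multiplication by a quaternion, as a real linear operator. -/
noncomputable def opSMul (q : ℍ) : H →L[ℝ] H :=
  LinearMap.mkContinuous
    { toFun := fun x => op q • x
      map_add' := smul_add (op q)
      map_smul' := fun r x => (smul_op_smul r q x).symm } ‖q‖ fun x => (norm_op_smul q x).le

theorem opSMul_apply (q : ℍ) (x : H) : opSMul H q x = op q • x := rfl

variable (H) in
/-- The action of `1, i, j, k` on a quaternionic Hilbert space. -/
noncomputable def quaternionFrame : ScalarFrame (Bool × Bool) H where
  unit a := opSMul H (quaternionUnit a)
  one := (false, false)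
  unit_one x := one_smul ℍᵐᵒᵖ x
  norm_unit a x := by rw [opSMul_apply, norm_op_smul, norm_quaternionUnit, one_mul]
  inner_unit_of_ne a b x hab := by
    rw [opSMul_apply, opSMul_apply, real_inner_eq_re, inner_op_smul_left, inner_op_smul_right,
      inner_self_eq, Quaternion.coe_mul_eq_smul, mul_smul_comm, Quaternion.re_smul,
      re_star_quaternionUnit_mul_of_ne hab, smul_zero]
  inner_unit_left a := by
    obtain ⟨s, hs⟩ := exists_star_quaternionUnit_eq_smul a
    refine ⟨s, fun x y => ?_⟩
    rw [opSMul_apply, opSMul_apply, real_inner_eq_re, real_inner_eq_re, inner_op_smul_left,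
      inner_op_smul_right, hs, re_mul_comm, mul_smul_comm, Quaternion.re_smul, smul_eq_mul]
  inner_unit_unit a b := by
    obtain ⟨c, s, hs⟩ := exists_quaternionUnit_mul_star_eq_smul a b
    refine ⟨c, s, fun x y => ?_⟩
    rw [opSMul_apply, opSMul_apply, opSMul_apply, real_inner_eq_re, real_inner_eq_re,
      inner_op_smul_left, inner_op_smul_left, inner_op_smul_right, re_mul_comm, mul_assoc,
      re_mul_comm, hs, smul_mul_assoc, Quaternion.re_smul, smul_eq_mul]

theorem quaternionFrame_unit (a : Bool × Bool) (x : H) :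
    (quaternionFrame H).unit a x = op (quaternionUnit a) • x := rfl

theorem forall_inner_quaternionFrame_eq_zero {x y : H} :
    (∀ a, inner ℝ ((quaternionFrame H).unit a x) y = 0) ↔ inner ℍ x y = 0 := by
  simp only [quaternionFrame_unit, real_inner_eq_re, inner_op_smul_left]
  exact ⟨eq_zero_of_re_star_quaternionUnit_mul, fun h a => by rw [h, mul_zero]; rfl⟩

/-- A quaternion is determined by the real parts of its products with the conjugate units, and these
are reached by scaling `y`, thanks to the linearity of `G`. -/
theorem inner_eq_of_forall_re_eq {F G : H → H} (hG : ∀ (q : ℍ) x, G (op q • x) = op q • G x)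
    (h : ∀ x y, (inner ℍ (F x) y).re = (inner ℍ x (G y)).re) (x y : H) :
    inner ℍ (F x) y = inner ℍ x (G y) := by
  rw [← sub_eq_zero]
  refine eq_zero_of_re_star_quaternionUnit_mul fun a => ?_
  have := h x (op (star (quaternionUnit a)) • y)
  rw [hG, inner_op_smul_right, inner_op_smul_right] at this
  rw [re_mul_comm, sub_mul, Quaternion.re_sub, this, sub_self]

/-- A real linear operator that commutes with `1, i, j, k` is `ℍ`-linear. -/
theorem exists_quaternionic_of_commute {G : H →L[ℝ] H}
    (hG : ∀ a x, G ((quaternionFrame H).unit a x) = (quaternionFrame H).unit a (G x)) :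
    ∃ G' : H →L[ℍᵐᵒᵖ] H, ∀ x, G' x = G x := by
  have hq : ∀ (q : ℍ) (x : H), G (op q • x) = op q • G x := by
    intro q x
    have h : ∀ z : H, op q • z =
        q.re • (quaternionFrame H).unit (false, false) z +
        q.imI • (quaternionFrame H).unit (true, false) z +
        q.imJ • (quaternionFrame H).unit (false, true) z +
        q.imK • (quaternionFrame H).unit (true, true) z := fun z => by
      conv_lhs => rw [eq_sum_smul_quaternionUnit q]
      simp only [op_add, op_smul, add_smul, smul_assoc, quaternionFrame_unit]
    simp only [h, map_add, map_smul, hG]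
  exact ⟨{ toFun := G
           map_add' := map_add G
           map_smul' := fun q x => hq (unop q) x
           cont := G.cont }, fun _ => rfl⟩

theorem IsAbsoluteValue.norm_eq {A B : H →L[ℍᵐᵒᵖ] H} (h : IsAbsoluteValue A B) (x : H) :
    ‖A x‖ = ‖B x‖ := by
  obtain ⟨hB, -, A', hA, hBB⟩ := h
  have h1 : B (B x) = A' (A x) := DFunLike.congr_fun hBB x
  have h2 := hA (A x) x
  rw [← h1, hB, inner_self_eq, inner_self_eq, Quaternion.coe_inj] at h2
  exact (pow_left_inj₀ (norm_nonneg _) (norm_nonneg _) two_ne_zero).1 h2.symm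

variable [CompleteSpace H]

theorem isBasis_quaternionFrame_iff {N : Set H} :
    (quaternionFrame H).IsBasis N ↔ IsHilbertBasis N := by
  rw [ScalarFrame.IsBasis, ScalarFrame.IsOrthonormal, IsHilbertBasis, and_assoc]
  simp only [forall_inner_quaternionFrame_eq_zero]
  refine and_congr_right fun _ => and_congr_right fun _ => ?_
  let W : Submodule ℝ H := (Submodule.span ℍᵐᵒᵖ N).restrictScalars ℝ
  change _ ↔ Dense (W : Set H)
  rw [Submodule.dense_iff_topologicalClosure_eq_top, Submodule.topologicalClosure_eq_top_iff,
    Submodule.eq_bot_iff]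
  refine forall_congr' fun y => imp_congr_left ?_
  rw [Submodule.mem_orthogonal]
  constructor
  · intro h z hz
    have hz' : z ∈ Submodule.span ℍᵐᵒᵖ N := hz
    have : inner ℍ z y = 0 := by
      induction hz' using Submodule.span_induction with
      | mem u hu => exact h u hu
      | zero => rw [← zero_smul ℍᵐᵒᵖ y, ← op_zero, inner_op_smul_left, star_zero, zero_mul]
      | add u v hu hv ihu ihv => rw [inner_add_left, ihu hu, ihv hv, add_zero]
      | smul q u hu ih => rw [← op_unop q, inner_op_smul_left, ih hu, mul_zero]
    rw [real_inner_eq_re, this]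
    rfl
  · intro h u hu
    rw [← forall_inner_quaternionFrame_eq_zero]
    exact fun a => h _ (Submodule.smul_mem _ (op (quaternionUnit a)) (Submodule.subset_span hu))

theorem IsTraceClass.diagonallySummable {A : H →L[ℍᵐᵒᵖ] H} (hA : IsTraceClass A) :
    DiagonallySummable A := by
  obtain ⟨B, hB, N, hN, hs⟩ := hA
  have hpos : (B.restrictScalars ℝ).IsPositive := by
    refine (ContinuousLinearMap.isPositive_def).2
      ⟨fun x y => congr(($(hB.1 x y)).re), fun x => ?_⟩
    obtain ⟨r, hr, hx⟩ := hB.2.1 x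
    change 0 ≤ (inner ℍ (B x) x).re
    rw [hB.1, hx, Quaternion.re_coe]
    exact hr
  have hs' : Summable fun u : N => inner ℝ (u : H) (B u) := by
    refine Quaternion.summable_coe.1 (hs.congr fun u => ?_)
    obtain ⟨r, -, hx⟩ := hB.2.1 u
    rw [real_inner_eq_re, hx, Quaternion.re_coe]
  obtain ⟨τ, hτ⟩ := ScalarFrame.summable_abs_inner (d := quaternionFrame H)
    (A := A.restrictScalars ℝ) hpos hB.norm_eq
    (fun a x => B.map_smul (op (quaternionUnit a)) x) (isBasis_quaternionFrame_iff.2 hN) hs'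
  intro M hM
  choose c hc hcz using exists_norm_eq_one_star_mul
  refine summable_of_sum_le (c := τ) (fun _ => norm_nonneg _) fun s => ?_
  let x : M → H := fun u => op (c (inner ℍ (u : H) (A u))) • (u : H)
  have hx : Orthonormal ℝ x := by
    refine ⟨fun u => ?_, fun u v huv => ?_⟩
    · rw [norm_op_smul, hc, hM.1 u u.2, one_mul]
    · change (inner ℍ (op _ • (u : H)) (op _ • (v : H))).re = 0
      rw [inner_op_smul_left, inner_op_smul_right,
        hM.2.1 u u.2 v v.2 (Subtype.coe_ne_coe.2 huv), zero_mul, mul_zero]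
      rfl
  refine le_trans (Finset.sum_le_sum fun u _ => ?_) (hτ x (fun u => (u : H)) hx
    (isBasis_quaternionFrame_iff.2 hM).1.orthonormal (ContinuousLinearMap.id ℝ H)
    ContinuousLinearMap.norm_id_le s)
  change _ ≤ |(inner ℍ (op (c (inner ℍ (u : H) (A u))) • (u : H)) (A u)).re|
  rw [inner_op_smul_left, hcz, Quaternion.re_coe]
  exact le_abs_self _

/-- The real adjoint and absolute value commute with the units, hence are `ℍ`-linear, and real
adjointness upgrades to quaternionic adjointness. -/
theorem DiagonallySummable.isTraceClass {A : H →L[ℍᵐᵒᵖ] H} (hA : DiagonallySummable A) :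
    IsTraceClass A := by
  have hAd : ∀ a x, A.restrictScalars ℝ ((quaternionFrame H).unit a x) =
      (quaternionFrame H).unit a (A.restrictScalars ℝ x) := fun a x =>
    A.map_smul (op (quaternionUnit a)) x
  have hsum : ∀ a, ∀ N, (quaternionFrame H).IsBasis N → Summable fun x : N =>
      |inner ℝ (x : H) ((quaternionFrame H).unit a (A.restrictScalars ℝ x))| := by
    intro a N hN
    refine (hA N (isBasis_quaternionFrame_iff.1 hN)).of_nonneg_of_le (fun _ => abs_nonneg _)
      fun x => ?_
    rw [quaternionFrame_unit, real_inner_eq_re, inner_op_smul_right]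
    refine (abs_re_le_norm _).trans ?_
    rw [norm_mul, norm_quaternionUnit, mul_one]
    rfl
  obtain ⟨B, hB, hBB, hcomm, N, hN, hs⟩ :=
    ScalarFrame.exists_abs_summable_inner (d := quaternionFrame H) (a₀ := (true, false))
      (A := A.restrictScalars ℝ)
      (fun x y => by
        rw [quaternionFrame_unit, quaternionFrame_unit, real_inner_eq_re, real_inner_eq_re,
          inner_op_smul_left, inner_op_smul_right, re_mul_comm]
        have : star (quaternionUnit (true, false)) = -quaternionUnit (true, false) := by
          ext <;> simp [re_quaternionUnit, imI_quaternionUnit, imJ_quaternionUnit,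
            imK_quaternionUnit]
        rw [this, mul_neg, Quaternion.re_neg])
      (fun a => by
        simp only [quaternionFrame_unit, smul_smul, ← op_mul]
        refine (quaternionUnit_commute_or a).imp (fun h x => by rw [h]) fun h x => by
          rw [h, op_neg, neg_smul])
      hAd
      (fun N hN => (hsum (false, false) N hN).congr fun x =>
        congrArg (fun z => |inner ℝ (x : H) z|) ((quaternionFrame H).unit_one _))
      (hsum (true, false))
  have hA'd := ScalarFrame.star_unit hAd
  have hBd : ∀ a x, B ((quaternionFrame H).unit a x) = (quaternionFrame H).unit a (B x) := by
    intro a x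
    have : Commute ((quaternionFrame H).unit a)
        (star (A.restrictScalars ℝ) * A.restrictScalars ℝ) := by
      ext x
      exact ((congr(star (A.restrictScalars ℝ) $(hAd a x))).trans (hA'd a _)).symm
    exact congr($((hcomm _ this).eq.symm) x)
  obtain ⟨A', hA'⟩ := exists_quaternionic_of_commute hA'd
  obtain ⟨B', hB'⟩ := exists_quaternionic_of_commute hBd
  have hB'adj : IsAdjoint B' B' := inner_eq_of_forall_re_eq (fun q x => B'.map_smul (op q) x)
    fun x y => by
      rw [hB', hB']
      exact hB.inner_left_eq_inner_right x y
  have hA'adj : IsAdjoint A A' := inner_eq_of_forall_re_eq (fun q x => A.map_smul (op q) x)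
    fun x y => by
      rw [hA']
      exact ContinuousLinearMap.adjoint_inner_left (A.restrictScalars ℝ) y x
  have hB're : ∀ u, inner ℍ u (B' u) = ((inner ℝ u (B u) : ℝ) : ℍ) := fun u => by
    rw [real_inner_eq_re, ← hB']
    exact Quaternion.star_eq_self.1 (by rw [star_inner, hB'adj])
  refine ⟨B', ⟨hB'adj, fun u => ⟨_, hB.inner_nonneg_right u, hB're u⟩, A', hA'adj, ?_⟩, N,
    isBasis_quaternionFrame_iff.1 hN, ?_⟩
  · ext x
    change B' (B' x) = A' (A x)
    rw [hB', hB', hA']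
    exact congr($hBB x)
  · simp only [hB're]
    exact Quaternion.summable_coe.2 hs

end

end QuaternionicHilbert

theorem proposition2p3 :
    -- complex Hilbert spaces
    (∀ (H : Type u) [NormedAddCommGroup H] [InnerProductSpace ℂ H] [CompleteSpace H]
      (A : H →L[ℂ] H), RCLikeHilbert.IsTraceClass A ↔ RCLikeHilbert.DiagonallySummable A) ∧
    -- quaternionic Hilbert spaces
    (∀ (H : Type u) [NormedAddCommGroup H] [Module ℍᵐᵒᵖ H] [QuaternionicInnerProductSpace H]
      [CompleteSpace H] (A : H →L[ℍᵐᵒᵖ] H),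
      QuaternionicHilbert.IsTraceClass A ↔ QuaternionicHilbert.DiagonallySummable A) ∧
    -- real Hilbert spaces
    (∀ (H : Type u) [NormedAddCommGroup H] [InnerProductSpace ℝ H] [CompleteSpace H]
      (A : H →L[ℝ] H), RCLikeHilbert.IsTraceClass A → RCLikeHilbert.DiagonallySummable A) ∧
    -- failure of the converse in every infinite-dimensional real Hilbert space
    (∀ (H : Type u) [NormedAddCommGroup H] [InnerProductSpace ℝ H] [CompleteSpace H],
      ¬ FiniteDimensional ℝ H →
        ∃ A : H →L[ℝ] H, RCLikeHilbert.DiagonallySummable A ∧ ¬ RCLikeHilbert.IsTraceClass A) := by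
  exact ⟨fun H _ _ _ A => ⟨fun h => h.diagonallySummable_complex, fun h => h.isTraceClass⟩,
    fun H _ _ _ _ A => ⟨fun h => h.diagonallySummable, fun h => h.isTraceClass⟩,
    fun H _ _ _ A h => h.diagonallySummable_real,
    fun H _ _ _ h => RCLikeHilbert.exists_diagonallySummable_not_isTraceClass h⟩
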